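/- Let $m\ge 1$ and let $\Gamma\subset\mathbb R^m\times\mathbb R$ be a lattice whose coordinate projections $p_1:\mathbb R^m\times\mathbb R\to\mathbb R^m$ and $p_2:\mathbb R^m\times\mathbb R\to\mathbb R$ are both injective on $\Gamma$, with $p_1(\Gamma)$ dense in $\mathbb R^m$ and $p_2(\Gamma)$ dense in $\mathbb R$. Let $\Omega\subset\mathbb R$ be a compact interval with non-empty interior, symmetric around the origin, and let $\Lambda(\Omega)=\{p_1(\gamma):\gamma\in\Gamma,\ p_2(\gamma)\in\Omega\}$ be the corresponding simple model set. Write $T_\lambda f(t)=f(t-\lambda)$, $\widehat f(\omega)=\int f(t)e^{-2\pi i t\cdot\omega}\,dt$, and let $W(L^2,\ell^1)$ be the space of measurable $f:\mathbb R^m\to\mathbb C$ with $\sum_{n\in\mathbb Z^m}\|f\,\mathbf 1_{[0,1]^m+n}\|_2<\infty$. A family $(u_i)$ in $L^2(\mathbb R^m)$ is a Bessel sequence with bound $B$ if $\sum_i|\langle f,u_i\rangle|^2\le B\|f\|_2^2$ for all $f\in L^2(\mathbb R^m)$. Let $\mathcal K$ be a countable set and $g_k\in W(L^2,\ell^1)$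 for $k\in\mathcal K$, and suppose that $\{T_\lambda g_k:k\in\mathcal K,\lambda\in\Lambda(\Omega)\}$ is a Bessel sequence with bound $B_g$. (a) Let $\psi:\mathbb R\to\mathbb R$ be a non-negative smooth function with support in $\Omega$, and put $w_\psi(\lambda)=\psi(p_2(\gamma))$ for $\lambda=p_1(\gamma)\in\Lambda(\Omega)$ with $\gamma\in\Gamma$. Then $\{w_\psi(\lambda)T_\lambda g_k:k\in\mathcal K,\lambda\in\Lambda(\Omega)\}$ is a Bessel sequence with bound $\|\psi\|_\infty^2B_g$, and $$\mathrm{vol}(\Gamma)^{-1}\,\widehat{\psi^2}(0)\sum_{k\in\mathcal K}|\widehat g_k(t)|^2\le\|\psi\|_\infty^2B_g\quad\text{for a.e. }t\in\mathbb R^m,$$ where $\widehat{\psi^2}(0)=\int_{\mathbb R}\psi(s)^2\,ds$ and $\mathrm{vol}(\Gamma)$ is the covolume of $\Gamma$. (b) In particular, the density $D(\Lambda(\Omega))=\lim_{R\to\infty}R^{-m}\,\#\bigl(\Lambda(\Omega)\cap(x+R[0,1]^m)\bigr)$ exists, with the same value $\mathrm{vol}(\Gamma)^{-1}|\Omega|$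 for every $x\in\mathbb R^m$, and $$D(\Lambda(\Omega))\sum_{k\in\mathcal K}|\widehat g_k(t)|^2\le B_g\quad\text{for a.e. }t\in\mathbb R^m.$$ -/

import Mathlib

open MeasureTheory Filter Topology
open scoped NNReal ENNReal FourierTransform ContDiff ComplexConjugate

namespace ModelSet

/-- The cube `B(x, R) = R [0,1]^m + x` in `ℝ^m`. -/
def cube {m : ℕ} (x : EuclideanSpace ℝ (Fin m)) (R : ℝ) : Set (EuclideanSpace ℝ (Fin m)) :=
  {y | ∀ i, y i ∈ Set.Icc (x i) (x i + R)}

/-- The point of `ℝ^m` with integer coordinates `k`. -/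
noncomputable def intPoint {m : ℕ} (k : Fin m → ℤ) : EuclideanSpace ℝ (Fin m) :=
  WithLp.toLp 2 fun i => (k i : ℝ)

/-- The Wiener amalgam norm `‖f‖_{p,1} = ∑_{k ∈ ℤ^m} ‖f 𝟙_{[0,1]^m + k}‖_p`. -/
noncomputable def wienerNorm {m : ℕ} (p : ℝ≥0∞) (f : EuclideanSpace ℝ (Fin m) → ℂ) : ℝ≥0∞ :=
  ∑' k : Fin m → ℤ, eLpNorm ((cube (intPoint k) 1).indicator f) p volume

/-- Membership in the Wiener amalgam space `W(L^p, ℓ^1)`. -/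
def MemWiener {m : ℕ} (p : ℝ≥0∞) (f : EuclideanSpace ℝ (Fin m) → ℂ) : Prop :=
  AEStronglyMeasurable f volume ∧ wienerNorm p f < (⊤ : ℝ≥0∞)

/-- The translation operator `T_x f (t) = f (t - x)`. -/
def translate {m : ℕ} (x : EuclideanSpace ℝ (Fin m)) (f : EuclideanSpace ℝ (Fin m) → ℂ) :
    EuclideanSpace ℝ (Fin m) → ℂ :=
  fun t => f (t - x)

/-- The family `u` of functions in `L²(ℝ^m)` is a Bessel sequence with upper bound `B`:
`∑_i |⟨f, u_i⟩|² ≤ B ‖f‖₂²` for every `f ∈ L²(ℝ^m)`, where `⟨f, h⟩ = ∫ f h̄`. -/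
def IsBessel {m : ℕ} {ι : Type*} (u : ι → EuclideanSpace ℝ (Fin m) → ℂ) (B : ℝ≥0) : Prop :=
  (∀ i, MemLp (u i) 2 volume) ∧
    ∀ f : EuclideanSpace ℝ (Fin m) → ℂ, MemLp f 2 volume →
      ∑' i, ‖∫ t, f t * conj (u i t)‖ₑ ^ 2 ≤ (B : ℝ≥0∞) * eLpNorm f 2 volume ^ 2

/-- The requirements on the projections of a lattice `Γ ⊂ ℝ^m × ℝ` defining simple model sets:
both `p₁` and `p₂` are injective on `Γ` and have dense image. -/
structure IsCutProject {m : ℕ} (Γ : Submodule ℤ (EuclideanSpace ℝ (Fin m) × ℝ)) : Prop where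
  injOn_fst : Set.InjOn Prod.fst (Γ : Set (EuclideanSpace ℝ (Fin m) × ℝ))
  dense_fst : Dense (Prod.fst '' (Γ : Set (EuclideanSpace ℝ (Fin m) × ℝ)))
  injOn_snd : Set.InjOn Prod.snd (Γ : Set (EuclideanSpace ℝ (Fin m) × ℝ))
  dense_snd : Dense (Prod.snd '' (Γ : Set (EuclideanSpace ℝ (Fin m) × ℝ)))

/-- A window in `ℝ` that is an interval. -/
structure IsIntervalWindow (Ω : Set ℝ) : Prop where
  nonempty : Ω.Nonempty
  isCompact : IsCompact Ω
  closure_interior : closure (interior Ω) = Ω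
  volume_frontier : volume (frontier Ω) = 0
  ordConnected : Ω.OrdConnected

/-- The model set `Λ(Ω) = {p₁(γ) : γ ∈ Γ, p₂(γ) ∈ Ω}`. -/
def modelSet {m : ℕ} (Γ : Submodule ℤ (EuclideanSpace ℝ (Fin m) × ℝ)) (Ω : Set ℝ) :
    Set (EuclideanSpace ℝ (Fin m)) :=
  {x | ∃ γ ∈ Γ, γ.2 ∈ Ω ∧ γ.1 = x}

/-- `Λ` has density `D`: for every `x`, `#(Λ ∩ B(x, R)) / R^m → D` as `R → ∞`; the sets counted are
required to be finite. -/
def HasDensity {m : ℕ} (Λ : Set (EuclideanSpace ℝ (Fin m))) (D : ℝ) : Prop :=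
  ∀ x : EuclideanSpace ℝ (Fin m),
    (∀ R : ℝ, (Λ ∩ cube x R).Finite) ∧
      Tendsto (fun R : ℝ => ((Λ ∩ cube x R).ncard : ℝ) / R ^ m) atTop (𝓝 D)

/-- `ψ ∈ C₀^∞(Ω)`: a smooth real-valued function on `ℝ` with support in `Ω`. -/
def IsSmoothOn (Ω : Set ℝ) (ψ : ℝ → ℝ) : Prop :=
  ContDiff ℝ ∞ ψ ∧ tsupport ψ ⊆ Ω

/-- The sup norm `‖ψ‖_∞` (of a bounded function). -/
noncomputable def supNorm (ψ : ℝ → ℝ) : ℝ≥0 := ⨆ s, ‖ψ s‖₊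

open Classical in
/-- The weight `w_ψ(λ) = ψ(p₂(γ))` for `λ = p₁(γ) ∈ Λ(Ω)`, and `w_ψ(λ) = 0` for `λ ∉ Λ(Ω)`. -/
noncomputable def weight {m : ℕ} (Γ : Submodule ℤ (EuclideanSpace ℝ (Fin m) × ℝ)) (Ω : Set ℝ)
    (ψ : ℝ → ℝ) (x : EuclideanSpace ℝ (Fin m)) : ℝ :=
  if h : ∃ γ ∈ Γ, γ.2 ∈ Ω ∧ γ.1 = x then ψ h.choose.2 else 0

/-- As `p₁` is injective on `Γ`, the choice in the definition of the weight is immaterial. -/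
theorem weight_fst {m : ℕ} {Γ : Submodule ℤ (EuclideanSpace ℝ (Fin m) × ℝ)}
    (hΓ : IsCutProject Γ) {Ω : Set ℝ} (ψ : ℝ → ℝ) {γ : EuclideanSpace ℝ (Fin m) × ℝ}
    (hγ : γ ∈ Γ) (hΩ : γ.2 ∈ Ω) : weight Γ Ω ψ γ.1 = ψ γ.2 := by
  have h : ∃ γ' ∈ Γ, γ'.2 ∈ Ω ∧ γ'.1 = γ.1 := ⟨γ, hγ, hΩ, rfl⟩
  have e : h.choose = γ := hΓ.injOn_fst h.choose_spec.1 hγ h.choose_spec.2.2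
  rw [weight, dif_pos h, e]

end ModelSet

/-! Test the Bessel inequality on the plane wave of frequency `ξ` cut off to the cube of side `R` at
the origin, whose squared norm is `R ^ m`. If `λ` lies at depth `r` inside the cube, the inner
product with `T_λ g_k` has modulus at least `|ĝ_k(ξ)|` minus the `L¹` mass of `g_k` outside the cube
of half-side `r`. Summing over such `λ`, dividing by `R ^ m`, and letting first `R → ∞`, then `r →
∞`, gives (b) at every `ξ` (`IsBessel.density_mul_tsum_le`). The weighted bound in (a) follows,
since `∫ ψ² ≤ ‖ψ‖_∞² |Ω|`.

For the density, the number of points of `Γ + v` in a box, integrated over `v` in a fundamental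
domain, is the volume of the box. Since `p₂(Γ)` is dense, every such `v` is within `ε` of a lattice
point in the window direction and within a fixed `C` in the others. The count for `v` is thus
squeezed between counts for `0` in slightly altered boxes (`IsCutProject.exists_ncard_bounds`). -/

namespace ModelSet

/-! ### Cubes and their volume -/

variable {m : ℕ}

/-- The point of `ℝ^m` all of whose coordinates are `r`. -/
noncomputable def diagPoint (m : ℕ) (r : ℝ) : EuclideanSpace ℝ (Fin m) :=
  WithLp.toLp 2 fun _ => r

@[simp]
theorem diagPoint_apply (r : ℝ) (i : Fin m) : diagPoint m r i = r := rfl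

theorem cube_eq_preimage (x : EuclideanSpace ℝ (Fin m)) (R : ℝ) :
    cube x R = WithLp.ofLp ⁻¹' Set.Icc (WithLp.ofLp x) (fun i => x i + R) := by
  ext y
  simp [cube, Pi.le_def, forall_and]

theorem measurableSet_cube (x : EuclideanSpace ℝ (Fin m)) (R : ℝ) :
    MeasurableSet (cube x R) := by
  rw [cube_eq_preimage]
  exact (EuclideanSpace.volume_preserving_symm_measurableEquiv_toLp (Fin m)).measurable
    measurableSet_Icc

theorem volume_cube (x : EuclideanSpace ℝ (Fin m)) (R : ℝ) :
    volume (cube x R) = ENNReal.ofReal R ^ m := by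
  rw [cube_eq_preimage, (PiLp.volume_preserving_ofLp (Fin m)).measure_preimage
    measurableSet_Icc.nullMeasurableSet, Real.volume_Icc_pi]
  simp

theorem isBounded_cube (x : EuclideanSpace ℝ (Fin m)) (R : ℝ) :
    Bornology.IsBounded (cube x R) := by
  rw [cube_eq_preimage]
  exact (PiLp.antilipschitzWith_ofLp 2 (fun _ : Fin m => ℝ)).isBounded_preimage
    (Metric.isBounded_Icc _ _)

theorem abs_apply_le_norm (x : EuclideanSpace ℝ (Fin m)) (i : Fin m) : |x i| ≤ ‖x‖ :=
  PiLp.norm_apply_le x i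

instance isAddHaarMeasure_volume_prod :
    (volume : Measure (EuclideanSpace ℝ (Fin m) × ℝ)).IsAddHaarMeasure :=
  inferInstanceAs ((volume : Measure (EuclideanSpace ℝ (Fin m))).prod
    (volume : Measure ℝ)).IsAddHaarMeasure

/-! ### Lattice point counts and the density of model sets -/

/-- The number of points of `Γ`, translated by `v`, in `A`. -/
noncomputable def latticeCount (Γ : Submodule ℤ (EuclideanSpace ℝ (Fin m) × ℝ))
    (v : EuclideanSpace ℝ (Fin m) × ℝ) (A : Set (EuclideanSpace ℝ (Fin m) × ℝ)) : ℝ≥0∞ :=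
  ({γ : Γ | (γ : EuclideanSpace ℝ (Fin m) × ℝ) + v ∈ A}.encard : ℝ≥0∞)

/-- Unfolding: the translates of `F` by `Γ` tile the space, so the integral of the indicator of `A`
becomes a sum over `Γ` under the integral on `F`. -/
theorem volume_eq_lintegral_latticeCount {Γ : Submodule ℤ (EuclideanSpace ℝ (Fin m) × ℝ)}
    [DiscreteTopology Γ] [IsZLattice ℝ Γ] {F : Set (EuclideanSpace ℝ (Fin m) × ℝ)}
    (hF : IsAddFundamentalDomain Γ F) {A : Set (EuclideanSpace ℝ (Fin m) × ℝ)}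
    (hA : MeasurableSet A) :
    volume A = ∫⁻ v in F, latticeCount Γ v A := by
  have : VAddInvariantMeasure Γ (EuclideanSpace ℝ (Fin m) × ℝ) volume :=
    inferInstanceAs <| VAddInvariantMeasure Γ.toAddSubgroup (EuclideanSpace ℝ (Fin m) × ℝ) volume
  rw [← lintegral_indicator_one hA, hF.lintegral_eq_tsum'', ← lintegral_tsum]
  · refine lintegral_congr fun v => ?_
    rw [latticeCount, ← ENNReal.tsum_set_one, tsum_subtype _ (fun _ => (1 : ℝ≥0∞))]
    rfl
  · intro γ
    refine Measurable.aemeasurable ?_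
    exact (measurable_one.indicator hA).comp (measurable_const_vadd γ)

/-- Points of a bounded set are approximated by points of `Γ`, to within `ε` in the last coordinate
and to within a uniform bound in the others. -/
theorem IsCutProject.exists_uniform_approx {Γ : Submodule ℤ (EuclideanSpace ℝ (Fin m) × ℝ)}
    (hΓ : IsCutProject Γ) {F : Set (EuclideanSpace ℝ (Fin m) × ℝ)} (hF : Bornology.IsBounded F)
    {ε : ℝ} (hε : 0 < ε) :
    ∃ C : ℝ, ∀ v ∈ F, ∃ γ ∈ Γ, |v.2 - γ.2| ≤ ε ∧ ‖v.1 - γ.1‖ ≤ C := by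
  have key : ∃ C : ℝ, ∀ v ∈ closure F, ∃ γ ∈ Γ, |v.2 - γ.2| ≤ ε ∧ ‖v.1 - γ.1‖ ≤ C := by
    -- The property passes to subsets and finite unions, so by compactness it suffices to have it
    -- near each point, where a single `γ` serves.
    refine hF.isCompact_closure.induction_on
      (p := fun S => ∃ C : ℝ, ∀ v ∈ S, ∃ γ ∈ Γ, |v.2 - γ.2| ≤ ε ∧ ‖v.1 - γ.1‖ ≤ C)
      ⟨0, by simp⟩ ?_ ?_ ?_
    · rintro s t hst ⟨C, hC⟩
      exact ⟨C, fun v hv => hC v (hst hv)⟩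
    · rintro s t ⟨C, hC⟩ ⟨C', hC'⟩
      refine ⟨max C C', ?_⟩
      rintro v (hv | hv)
      · obtain ⟨γ, h, h1, h2⟩ := hC v hv
        exact ⟨γ, h, h1, h2.trans (le_max_left _ _)⟩
      · obtain ⟨γ, h, h1, h2⟩ := hC' v hv
        exact ⟨γ, h, h1, h2.trans (le_max_right _ _)⟩
    · intro x _
      obtain ⟨_, ⟨γ, hγ, rfl⟩, hx⟩ := hΓ.dense_snd.exists_dist_lt x.2 hε
      refine ⟨{v | |v.2 - γ.2| < ε ∧ ‖v.1 - γ.1‖ < ‖x.1 - γ.1‖ + 1}, ?_, ‖x.1 - γ.1‖ + 1, ?_⟩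
      · refine mem_nhdsWithin_of_mem_nhds (IsOpen.mem_nhds ?_ ⟨hx, by simp⟩)
        have h1 : IsOpen {v : EuclideanSpace ℝ (Fin m) × ℝ | |v.2 - γ.2| < ε} :=
          isOpen_lt (by fun_prop) (by fun_prop)
        have h2 : IsOpen {v : EuclideanSpace ℝ (Fin m) × ℝ | ‖v.1 - γ.1‖ < ‖x.1 - γ.1‖ + 1} :=
          isOpen_lt (by fun_prop) (by fun_prop)
        exact h1.inter h2
      · rintro v ⟨h1, h2⟩
        exact ⟨γ, hγ, h1.le, h2.le⟩
  obtain ⟨C, hC⟩ := key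
  exact ⟨C, fun v hv => hC v (subset_closure hv)⟩

/-- Translating by a lattice point does not change which translates of `Γ` are counted. -/
theorem latticeCount_le_of_approx {Γ : Submodule ℤ (EuclideanSpace ℝ (Fin m) × ℝ)}
    {v w γ : EuclideanSpace ℝ (Fin m) × ℝ} (hγ : γ ∈ Γ) {ε C : ℝ}
    (h2 : |v.2 - w.2 - γ.2| ≤ ε) (h1 : ‖v.1 - w.1 - γ.1‖ ≤ C)
    (x : EuclideanSpace ℝ (Fin m)) (R c d : ℝ) :
    latticeCount Γ v (cube x R ×ˢ Set.Icc c d) ≤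
      latticeCount Γ w (cube (x - diagPoint m C) (R + 2 * C) ×ˢ Set.Icc (c - ε) (d + ε)) := by
  refine ENat.toENNReal_le.2 ?_
  -- The points `γ' + v` and `γ' + γ + w` differ by `v - w - γ`, so enlarging the box by `C` and `ε`
  -- absorbs the shift.
  refine Set.encard_le_encard_of_injOn (f := fun γ' : Γ => γ' + ⟨γ, hγ⟩) ?_
    (add_left_injective _).injOn
  rintro γ' ⟨ha, hb, hc⟩
  simp only [Prod.fst_add, Prod.snd_add] at ha hb hc
  rw [abs_le] at h2
  refine ⟨fun i => ?_, ?_, ?_⟩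
  · have h3 := (abs_apply_le_norm _ i).trans h1
    rw [abs_le] at h3
    have h4 := ha i
    simp only [PiLp.sub_apply, PiLp.add_apply, Set.mem_Icc] at h3 h4
    simp only [Submodule.coe_add, Prod.fst_add, PiLp.add_apply, PiLp.sub_apply, diagPoint_apply,
      Set.mem_Icc]
    constructor <;> linarith
  · simp only [Submodule.coe_add, Prod.snd_add]
    linarith
  · simp only [Submodule.coe_add, Prod.snd_add]
    linarith

theorem modelSet_inter_cube_eq_image {Γ : Submodule ℤ (EuclideanSpace ℝ (Fin m) × ℝ)}
    (Ω : Set ℝ) (x : EuclideanSpace ℝ (Fin m)) (R : ℝ) :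
    modelSet Γ Ω ∩ cube x R =
      (fun γ : Γ => (γ : EuclideanSpace ℝ (Fin m) × ℝ).1) ''
        {γ : Γ | (γ : EuclideanSpace ℝ (Fin m) × ℝ) + 0 ∈ cube x R ×ˢ Ω} := by
  ext y
  constructor
  · rintro ⟨⟨γ, hγ, hΩ, rfl⟩, hy⟩
    exact ⟨⟨γ, hγ⟩, by simpa using ⟨hy, hΩ⟩, rfl⟩
  · rintro ⟨⟨γ, hγ⟩, h, rfl⟩
    simp only [add_zero, Set.mem_ofPred_eq, Set.mem_prod] at h
    exact ⟨⟨γ, hγ, h.2, rfl⟩, h.1⟩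

theorem finite_modelSet_inter_cube {Γ : Submodule ℤ (EuclideanSpace ℝ (Fin m) × ℝ)}
    [DiscreteTopology Γ] (c d : ℝ) (x : EuclideanSpace ℝ (Fin m)) (R : ℝ) :
    (modelSet Γ (Set.Icc c d) ∩ cube x R).Finite := by
  rw [modelSet_inter_cube_eq_image]
  refine Set.Finite.image _ ?_
  have : (cube x R ×ˢ Set.Icc c d ∩ (Γ : Set (EuclideanSpace ℝ (Fin m) × ℝ))).Finite := by
    refine Metric.finite_isBounded_inter_isClosed DiscreteTopology.isDiscrete
      ((isBounded_cube x R).prod (Metric.isBounded_Icc c d)) ?_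
    rw [← Submodule.coe_toAddSubgroup]
    exact AddSubgroup.isClosed_of_discrete
  refine (this.preimage (Subtype.val_injective (p := (· ∈ Γ))).injOn).subset ?_
  rintro γ hγ
  exact ⟨by simpa using hγ, γ.2⟩

/-- Injectivity of `p₁` on `Γ` ensures that no two lattice points give the same point of the model
set. -/
theorem IsCutProject.latticeCount_eq_ncard {Γ : Submodule ℤ (EuclideanSpace ℝ (Fin m) × ℝ)}
    [DiscreteTopology Γ] (hΓ : IsCutProject Γ) (c d : ℝ) (x : EuclideanSpace ℝ (Fin m)) (R : ℝ) :
    latticeCount Γ 0 (cube x R ×ˢ Set.Icc c d) =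
      ENNReal.ofReal (modelSet Γ (Set.Icc c d) ∩ cube x R).ncard := by
  have hinj : Function.Injective (fun γ : Γ => (γ : EuclideanSpace ℝ (Fin m) × ℝ).1) :=
    fun a b h => Subtype.ext (hΓ.injOn_fst a.2 b.2 h)
  rw [ENNReal.ofReal_natCast, ← ENat.toENNReal_coe,
    (finite_modelSet_inter_cube c d x R).cast_ncard_eq, modelSet_inter_cube_eq_image,
    hinj.encard_image, latticeCount]

/-- Two-sided bounds, with an error of lower order, for the number of points of a model set in a
cube. -/
theorem IsCutProject.exists_ncard_bounds {Γ : Submodule ℤ (EuclideanSpace ℝ (Fin m) × ℝ)}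
    [DiscreteTopology Γ] [IsZLattice ℝ Γ] (hΓ : IsCutProject Γ) {c d : ℝ} (hcd : c ≤ d) {ε : ℝ}
    (hε : 0 < ε) :
    ∃ C : ℝ, ∀ (x : EuclideanSpace ℝ (Fin m)) (R : ℝ), 0 ≤ R - 2 * C → 0 ≤ R + 2 * C →
      (R - 2 * C) ^ m * (d - c - 2 * ε) ≤
          (modelSet Γ (Set.Icc c d) ∩ cube x R).ncard * ZLattice.covolume Γ ∧
        (modelSet Γ (Set.Icc c d) ∩ cube x R).ncard * ZLattice.covolume Γ ≤
          (R + 2 * C) ^ m * (d - c + 2 * ε) := by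
  let b := Module.Free.chooseBasis ℤ Γ
  set F := ZSpan.fundamentalDomain (b.ofZLatticeBasis ℝ) with hFdef
  have hF : IsAddFundamentalDomain Γ F := ZLattice.isAddFundamentalDomain b volume
  have hFb : Bornology.IsBounded F := ZSpan.fundamentalDomain_isBounded _
  have hFm : MeasurableSet F := ZSpan.fundamentalDomain_measurableSet _
  have hcov : volume F = ENNReal.ofReal (ZLattice.covolume Γ) := by
    rw [ZLattice.covolume_eq_measure_fundamentalDomain Γ volume hF, Measure.real,
      ENNReal.ofReal_toReal hFb.measure_lt_top.ne]
  have hcov0 : 0 ≤ ZLattice.covolume Γ := (ZLattice.covolume_pos Γ volume).le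
  have hvol : ∀ (x : EuclideanSpace ℝ (Fin m)) (R c d : ℝ),
      volume (cube x R ×ˢ Set.Icc c d) = ENNReal.ofReal R ^ m * ENNReal.ofReal (d - c) := by
    intro x R c d
    rw [Measure.volume_eq_prod, Measure.prod_prod, volume_cube, Real.volume_Icc]
  obtain ⟨C, hC⟩ := hΓ.exists_uniform_approx hFb hε
  refine ⟨C, fun x R hR hR' => ⟨?_, ?_⟩⟩
  · rcases le_or_gt (d - c - 2 * ε) 0 with h0 | h0
    · exact (mul_nonpos_of_nonneg_of_nonpos (by positivity) h0).trans (by positivity)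
    -- The box is shrunk in advance so that passing from `v` to `0` enlarges it to exactly `cube x R
    -- ×ˢ Set.Icc c d`.
    have h := hvol (x + diagPoint m C) (R - 2 * C) (c + ε) (d - ε)
    rw [volume_eq_lintegral_latticeCount hF
      ((measurableSet_cube _ _).prod measurableSet_Icc)] at h
    have hle : ∫⁻ v in F, latticeCount Γ v
        (cube (x + diagPoint m C) (R - 2 * C) ×ˢ Set.Icc (c + ε) (d - ε)) ≤
        ∫⁻ _ in F, latticeCount Γ 0 (cube x R ×ˢ Set.Icc c d) := by
      refine setLIntegral_mono' hFm fun v hv => ?_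
      obtain ⟨γ, hγ, h2, h1⟩ := hC v hv
      have := latticeCount_le_of_approx (w := 0) hγ (by simpa using h2) (by simpa using h1)
        (x + diagPoint m C) (R - 2 * C) (c + ε) (d - ε)
      simpa using this
    rw [h, setLIntegral_const, hcov, hΓ.latticeCount_eq_ncard, ← ENNReal.ofReal_pow hR,
      ← ENNReal.ofReal_mul (by positivity), ← ENNReal.ofReal_mul (by positivity),
      ENNReal.ofReal_le_ofReal_iff (by positivity)] at hle
    linarith
  · have h := hvol (x - diagPoint m C) (R + 2 * C) (c - ε) (d + ε)
    rw [volume_eq_lintegral_latticeCount hF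
      ((measurableSet_cube _ _).prod measurableSet_Icc)] at h
    have hle : ∫⁻ _ in F, latticeCount Γ 0 (cube x R ×ˢ Set.Icc c d) ≤ ∫⁻ v in F, latticeCount Γ v
        (cube (x - diagPoint m C) (R + 2 * C) ×ˢ Set.Icc (c - ε) (d + ε)) := by
      refine setLIntegral_mono' hFm fun v hv => ?_
      obtain ⟨γ, hγ, h2, h1⟩ := hC v hv
      -- The same approximation read from `0` to `v`, hence the sign of `γ`.
      refine latticeCount_le_of_approx (v := 0) (w := v) (γ := -γ) (Γ.neg_mem hγ) ?_ ?_ x R c d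
      · rw [← abs_neg]
        simpa [add_comm, sub_eq_add_neg] using h2
      · rw [← norm_neg]
        simpa [add_comm, sub_eq_add_neg] using h1
    have hpos : 0 ≤ d - c + 2 * ε := by linarith
    rw [h, setLIntegral_const, hcov, hΓ.latticeCount_eq_ncard, ← ENNReal.ofReal_pow hR',
      ← ENNReal.ofReal_mul (by positivity), ← ENNReal.ofReal_mul (by positivity),
      ENNReal.ofReal_le_ofReal_iff (mul_nonneg (by positivity) (by linarith))] at hle
    linarith

theorem tendsto_add_const_pow_div (m : ℕ) (C E : ℝ) :
    Tendsto (fun R : ℝ => (R + C) ^ m * E / R ^ m) atTop (𝓝 E) := by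
  have h1 : Tendsto (fun R : ℝ => (1 + C / R) ^ m * E) atTop (𝓝 ((1 + 0) ^ m * E)) :=
    ((tendsto_const_nhds.add (tendsto_const_nhds.div_atTop tendsto_id)).pow m).mul_const E
  rw [add_zero, one_pow, one_mul] at h1
  refine h1.congr' ?_
  filter_upwards [eventually_gt_atTop 0] with R hR
  rw [one_add_div hR.ne', div_pow]
  ring

/-- A model set whose window is an interval has density `|Ω| / vol(Γ)`. -/
theorem IsCutProject.hasDensity_modelSet {Γ : Submodule ℤ (EuclideanSpace ℝ (Fin m) × ℝ)}
    [DiscreteTopology Γ] [IsZLattice ℝ Γ] (hΓ : IsCutProject Γ) {c d : ℝ} (hcd : c ≤ d) :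
    HasDensity (modelSet Γ (Set.Icc c d)) ((ZLattice.covolume Γ)⁻¹ * (d - c)) := by
  intro x
  refine ⟨fun R => finite_modelSet_inter_cube c d x R, ?_⟩
  have hV : 0 < ZLattice.covolume Γ := ZLattice.covolume_pos Γ volume
  set V := ZLattice.covolume Γ
  refine tendsto_order.2 ⟨fun a ha => ?_, fun a ha => ?_⟩
  · have ha' : a * V < d - c := by
      rwa [inv_mul_eq_div, lt_div_iff₀ hV] at ha
    -- With `ε` a quarter of the gap, the loss `2 * ε` leaves half of it, so the limit stays
    -- strictly above `a * V`.
    obtain ⟨C, hC⟩ := hΓ.exists_ncard_bounds hcd (ε := (d - c - a * V) / 4) (by linarith)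
    have ht := tendsto_add_const_pow_div m (-(2 * C)) ((d - c - 2 * ((d - c - a * V) / 4)))
    -- The sign of `C` is unknown, so both `2 * C` and `-(2 * C)` serve as thresholds for `R`.
    filter_upwards [ht.eventually_const_lt (show a * V < _ by linarith), eventually_gt_atTop 0,
      eventually_ge_atTop (2 * C), eventually_ge_atTop (-(2 * C))] with R h1 h2 h3 h4
    have h5 := (hC x R (by linarith) (by linarith)).1
    rw [lt_div_iff₀ (by positivity)] at h1 ⊢
    rw [← sub_eq_add_neg] at h1
    refine lt_of_mul_lt_mul_right ?_ hV.le
    linarith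
  · have ha' : d - c < a * V := by
      rwa [gt_iff_lt, inv_mul_eq_div, div_lt_iff₀ hV] at ha
    obtain ⟨C, hC⟩ := hΓ.exists_ncard_bounds hcd (ε := (a * V - (d - c)) / 4) (by linarith)
    have ht := tendsto_add_const_pow_div m (2 * C) ((d - c + 2 * ((a * V - (d - c)) / 4)))
    filter_upwards [ht.eventually_lt_const (show _ < a * V by linarith), eventually_gt_atTop 0,
      eventually_ge_atTop (2 * C), eventually_ge_atTop (-(2 * C))] with R h1 h2 h3 h4
    have h5 := (hC x R (by linarith) (by linarith)).2
    rw [div_lt_iff₀ (by positivity)] at h1 ⊢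
    refine lt_of_mul_lt_mul_right ?_ hV.le
    linarith

/-! ### Integrability of amalgam functions and plane waves -/

theorem mem_cube_floor (t : EuclideanSpace ℝ (Fin m)) :
    t ∈ cube (intPoint fun i => ⌊t i⌋) 1 :=
  fun _ => ⟨Int.floor_le _, (Int.lt_floor_add_one _).le⟩

/-- On a unit cube, a probability space, the `L¹` norm is at most the `L²` norm; sum over the
integer cubes. -/
theorem MemWiener.integrable {f : EuclideanSpace ℝ (Fin m) → ℂ} (hf : MemWiener 2 f) :
    Integrable f := by
  refine ⟨hf.1, ?_⟩
  have hcover : (⋃ k : Fin m → ℤ, cube (intPoint k) 1) = Set.univ :=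
    Set.eq_univ_of_forall fun t => Set.mem_iUnion.2 ⟨_, mem_cube_floor t⟩
  calc ∫⁻ t, ‖f t‖ₑ = ∫⁻ t in ⋃ k : Fin m → ℤ, cube (intPoint k) 1, ‖f t‖ₑ := by
        rw [hcover, Measure.restrict_univ]
    _ ≤ ∑' k : Fin m → ℤ, ∫⁻ t in cube (intPoint k) 1, ‖f t‖ₑ := lintegral_iUnion_le _ _
    _ ≤ ∑' k : Fin m → ℤ, eLpNorm ((cube (intPoint k) 1).indicator f) 2 volume := by
        refine ENNReal.tsum_le_tsum fun k => ?_
        have : IsProbabilityMeasure (volume.restrict (cube (intPoint k) 1)) :=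
          ⟨by rw [Measure.restrict_apply_univ, volume_cube]; simp⟩
        rw [eLpNorm_indicator_eq_eLpNorm_restrict (measurableSet_cube _ _),
          ← eLpNorm_one_eq_lintegral_enorm]
        exact eLpNorm_le_eLpNorm_of_exponent_le one_le_two hf.1.restrict
    _ < ⊤ := hf.2

/-- The plane wave `t ↦ e^{2 π i t · ξ}`. -/
noncomputable def planeWave (ξ t : EuclideanSpace ℝ (Fin m)) : ℂ :=
  Complex.exp (↑(2 * Real.pi * inner ℝ t ξ) * Complex.I)

@[simp]
theorem norm_planeWave (ξ t : EuclideanSpace ℝ (Fin m)) : ‖planeWave ξ t‖ = 1 :=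
  Complex.norm_exp_ofReal_mul_I _

theorem planeWave_add (ξ s t : EuclideanSpace ℝ (Fin m)) :
    planeWave ξ (s + t) = planeWave ξ s * planeWave ξ t := by
  rw [planeWave, planeWave, planeWave, ← Complex.exp_add, inner_add_left]
  push_cast
  ring_nf

theorem continuous_planeWave (ξ : EuclideanSpace ℝ (Fin m)) : Continuous (planeWave ξ) := by
  unfold planeWave
  fun_prop

theorem conj_fourier_eq_integral (g : EuclideanSpace ℝ (Fin m) → ℂ)
    (ξ : EuclideanSpace ℝ (Fin m)) :
    conj (𝓕 g ξ) = ∫ t, planeWave ξ t * conj (g t) := by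
  rw [Real.fourier_eq', ← integral_conj]
  refine integral_congr_ae (Eventually.of_forall fun t => ?_)
  simp only [smul_eq_mul, map_mul, ← Complex.exp_conj, planeWave, Complex.conj_ofReal,
    Complex.conj_I]
  congr 2
  push_cast
  ring

theorem memLp_indicator_planeWave (ξ x : EuclideanSpace ℝ (Fin m)) (R : ℝ) :
    MemLp ((cube x R).indicator (planeWave ξ)) 2 := by
  rw [memLp_indicator_iff_restrict (measurableSet_cube x R)]
  have : IsFiniteMeasure (volume.restrict (cube x R)) :=
    ⟨by rw [Measure.restrict_apply_univ]; exact (isBounded_cube x R).measure_lt_top⟩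
  exact MemLp.of_bound (continuous_planeWave ξ).aestronglyMeasurable 1
    (Eventually.of_forall fun t => (norm_planeWave ξ t).le)

theorem eLpNorm_indicator_planeWave_sq (ξ x : EuclideanSpace ℝ (Fin m)) (R : ℝ) :
    eLpNorm ((cube x R).indicator (planeWave ξ)) 2 volume ^ 2 = ENNReal.ofReal R ^ m := by
  have h : eLpNorm ((cube x R).indicator (planeWave ξ)) 2 volume =
      eLpNorm ((cube x R).indicator fun _ => (1 : ℂ)) 2 volume := by
    refine eLpNorm_congr_norm_ae (Eventually.of_forall fun t => ?_)
    by_cases ht : t ∈ cube x R <;> simp [ht]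
  rw [h, eLpNorm_indicator_const (measurableSet_cube x R) two_ne_zero ENNReal.ofNat_ne_top,
    volume_cube, enorm_one, one_mul, ← ENNReal.rpow_natCast, ← ENNReal.rpow_mul]
  simp

/-! ### Testing the Bessel inequality on truncated plane waves -/

/-- The mass of `g` outside the cube of side length `2 r` centred at the origin. -/
noncomputable def tailMass (g : EuclideanSpace ℝ (Fin m) → ℂ) (r : ℝ) : ℝ :=
  ∫ t in (cube (diagPoint m (-r)) (2 * r))ᶜ, ‖g t‖

theorem tendsto_tailMass {g : EuclideanSpace ℝ (Fin m) → ℂ} (hg : Integrable g) :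
    Tendsto (tailMass g) atTop (𝓝 0) := by
  have h : Tendsto (fun r => ∫ t, (cube (diagPoint m (-r)) (2 * r))ᶜ.indicator (fun t => ‖g t‖) t)
      atTop (𝓝 (∫ _ : EuclideanSpace ℝ (Fin m), (0 : ℝ))) := by
    refine tendsto_integral_filter_of_dominated_convergence (fun t => ‖g t‖) ?_ ?_ hg.norm ?_
    · exact Eventually.of_forall fun r =>
        hg.norm.aestronglyMeasurable.indicator (measurableSet_cube _ _).compl
    · refine Eventually.of_forall fun r => Eventually.of_forall fun t => ?_
      exact (norm_indicator_le_norm_self _ _).trans (by simp)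
    · refine Eventually.of_forall fun t => tendsto_const_nhds.congr' ?_
      filter_upwards [eventually_ge_atTop ‖t‖] with r hr
      rw [Set.indicator_of_notMem]
      intro ht
      refine ht fun i => ?_
      have := abs_le.1 ((abs_apply_le_norm t i).trans hr)
      rw [diagPoint_apply]
      exact ⟨this.1, by linarith [this.2]⟩
  rw [integral_zero] at h
  exact h.congr fun r => integral_indicator (measurableSet_cube _ _).compl

/-- Testing a translate of `g` that is centred well inside a cube against a plane wave on that cube
recovers the Fourier transform of `g`, up to the tail of `g`. -/
theorem norm_fourier_sub_tailMass_le {g : EuclideanSpace ℝ (Fin m) → ℂ} (hg : Integrable g)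
    (ξ : EuclideanSpace ℝ (Fin m)) {r R : ℝ} {x : EuclideanSpace ℝ (Fin m)}
    (hx : x ∈ cube (diagPoint m r) (R - 2 * r)) :
    ‖𝓕 g ξ‖ - tailMass g r ≤
      ‖∫ t, (cube 0 R).indicator (planeWave ξ) t * conj (translate x g t)‖ := by
  have hconj : Integrable fun s => conj (g s) :=
    (integrable_norm_iff (Complex.continuous_conj.comp_aestronglyMeasurable hg.1)).1
      (by simpa using hg.norm)
  have hshift : ∫ t, (cube 0 R).indicator (planeWave ξ) t * conj (translate x g t) =
      ∫ s, (cube 0 R).indicator (planeWave ξ) (s + x) * conj (g s) := by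
    rw [← integral_add_right_eq_self _ x]
    simp [translate]
  have hwave : planeWave ξ x * conj (𝓕 g ξ) = ∫ s, planeWave ξ (s + x) * conj (g s) := by
    rw [conj_fourier_eq_integral, ← integral_const_mul]
    refine integral_congr_ae (Eventually.of_forall fun s => ?_)
    simp only [planeWave_add]
    ring
  have hint1 : Integrable fun s => planeWave ξ (s + x) * conj (g s) :=
    hconj.bdd_mul (c := 1) ((continuous_planeWave ξ).comp
      (continuous_add_const x)).aestronglyMeasurable
      (Eventually.of_forall fun s => (norm_planeWave ξ _).le)
  have hint2 : Integrable fun s => (cube 0 R).indicator (planeWave ξ) (s + x) * conj (g s) := by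
    refine hconj.bdd_mul (c := 1) ?_ (Eventually.of_forall fun s => ?_)
    · exact (((continuous_planeWave ξ).measurable.indicator (measurableSet_cube 0 R)).comp
        (measurable_add_const x)).aestronglyMeasurable
    · exact (norm_indicator_le_norm_self _ _).trans (norm_planeWave ξ _).le
  have hdiff : ‖planeWave ξ x * conj (𝓕 g ξ) -
      ∫ t, (cube 0 R).indicator (planeWave ξ) t * conj (translate x g t)‖ ≤ tailMass g r := by
    rw [hshift, hwave, ← integral_sub hint1 hint2, tailMass,
      ← integral_indicator (measurableSet_cube _ _).compl]
    refine norm_integral_le_of_norm_le (hg.norm.indicator (measurableSet_cube _ _).compl)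
      (Eventually.of_forall fun s => ?_)
    rw [← sub_mul, norm_mul, RCLike.norm_conj]
    -- For `s` in the central cube, `s + x` stays in the large cube and the integrand vanishes;
    -- elsewhere the truncation error has modulus at most `1`.
    by_cases hs : s ∈ cube (diagPoint m (-r)) (2 * r)
    · have hsx : s + x ∈ cube 0 R := by
        intro i
        have h1 := hs i
        have h2 := hx i
        simp only [diagPoint_apply, Set.mem_Icc] at h1 h2
        simp only [PiLp.add_apply, PiLp.zero_apply, Set.mem_Icc]
        constructor <;> linarith
      simp [Set.indicator_of_mem hsx, hs]
    · rw [Set.indicator_of_mem (Set.mem_compl hs)]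
      refine mul_le_of_le_one_left (norm_nonneg _) ?_
      by_cases hsx : s + x ∈ cube 0 R
      · simp [hsx]
      · simp [hsx]
  have h := norm_sub_norm_le (planeWave ξ x * conj (𝓕 g ξ))
    (∫ t, (cube 0 R).indicator (planeWave ξ) t * conj (translate x g t))
  rw [norm_mul, norm_planeWave, one_mul, RCLike.norm_conj] at h
  linarith

/-- Only the finitely many pairs with `k ∈ S` and `λ` deep in the cube are kept. The `max` with `0`
lets the lower bound be squared even when the tail dominates. -/
theorem IsBessel.ncard_mul_sum_le {Λ : Set (EuclideanSpace ℝ (Fin m))}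
    {K : Type*} {g : K → EuclideanSpace ℝ (Fin m) → ℂ} (hg : ∀ k, Integrable (g k)) {B : ℝ≥0}
    (hB : IsBessel (fun i : K × Λ => translate (i.2 : EuclideanSpace ℝ (Fin m)) (g i.1)) B)
    (ξ : EuclideanSpace ℝ (Fin m)) (S : Finset K) {r R : ℝ} (hR : 0 ≤ R)
    (hfin : (Λ ∩ cube (diagPoint m r) (R - 2 * r)).Finite) :
    (Λ ∩ cube (diagPoint m r) (R - 2 * r)).ncard *
      ∑ k ∈ S, max (‖𝓕 (g k) ξ‖ - tailMass (g k) r) 0 ^ 2 ≤ B * R ^ m := by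
  have hfin' : ((↑) ⁻¹' cube (diagPoint m r) (R - 2 * r) : Set Λ).Finite := by
    refine (hfin.preimage Subtype.val_injective.injOn).subset ?_
    exact fun y hy => ⟨y.2, hy⟩
  have hcard : (hfin'.toFinset.card : ℝ) = (Λ ∩ cube (diagPoint m r) (R - 2 * r)).ncard := by
    rw [← Set.ncard_eq_toFinset_card _ hfin', ← Subtype.image_preimage_coe,
      Set.ncard_image_of_injective _ Subtype.val_injective]
  have h := hB.2 _ (memLp_indicator_planeWave ξ 0 R)
  rw [eLpNorm_indicator_planeWave_sq] at h
  have h1 : ∑ i ∈ S ×ˢ hfin'.toFinset,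
      ENNReal.ofReal (max (‖𝓕 (g i.1) ξ‖ - tailMass (g i.1) r) 0 ^ 2) ≤
      ENNReal.ofReal (B * R ^ m) := by
    calc _ ≤ ∑ i ∈ S ×ˢ hfin'.toFinset, ‖∫ t, (cube 0 R).indicator (planeWave ξ) t *
          conj (translate (i.2 : EuclideanSpace ℝ (Fin m)) (g i.1) t)‖ₑ ^ 2 := by
          refine Finset.sum_le_sum fun i hi => ?_
          rw [← ofReal_norm, ENNReal.ofReal_pow (le_max_right _ _)]
          gcongr
          refine max_le (norm_fourier_sub_tailMass_le (hg i.1) ξ ?_) (norm_nonneg _)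
          exact hfin'.mem_toFinset.1 (Finset.mem_product.1 hi).2
      _ ≤ _ := (ENNReal.sum_le_tsum _).trans h
      _ = _ := by
          rw [ENNReal.ofReal_mul (by positivity), ENNReal.ofReal_pow hR,
            ENNReal.ofReal_coe_nnreal]
  rw [← ENNReal.ofReal_sum_of_nonneg (fun i _ => by positivity),
    ENNReal.ofReal_le_ofReal_iff (by positivity), Finset.sum_product] at h1
  simpa [Finset.mul_sum, ← hcard] using h1

/-- If the translates of the `g k` along a set of density `D` form a Bessel sequence with bound `B`,
then `D ∑ |ĝ_k|² ≤ B` everywhere. -/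
theorem IsBessel.density_mul_tsum_le {Λ : Set (EuclideanSpace ℝ (Fin m))} {D : ℝ}
    (hD : HasDensity Λ D)
    {K : Type*} {g : K → EuclideanSpace ℝ (Fin m) → ℂ} (hg : ∀ k, Integrable (g k)) {B : ℝ≥0}
    (hB : IsBessel (fun i : K × Λ => translate (i.2 : EuclideanSpace ℝ (Fin m)) (g i.1)) B)
    (ξ : EuclideanSpace ℝ (Fin m)) :
    ENNReal.ofReal D * ∑' k, ‖𝓕 (g k) ξ‖ₑ ^ 2 ≤ B := by
  have hr : ∀ (S : Finset K) (r : ℝ),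
      D * ∑ k ∈ S, max (‖𝓕 (g k) ξ‖ - tailMass (g k) r) 0 ^ 2 ≤ B := by
    intro S r
    -- The inner cube has side `R - 2 * r` while the norm gives `R ^ m`; the extra factor, which
    -- tends to `1`, corrects for this.
    have h1 : Tendsto (fun R : ℝ => ((Λ ∩ cube (diagPoint m r) (R - 2 * r)).ncard : ℝ) /
        (R - 2 * r) ^ m * ((R + -(2 * r)) ^ m * 1 / R ^ m)) atTop (𝓝 (D * 1)) :=
      (((hD (diagPoint m r)).2.comp (tendsto_atTop_add_const_right atTop (-(2 * r))
        tendsto_id))).mul (tendsto_add_const_pow_div m _ 1)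
    rw [mul_one] at h1
    refine le_of_tendsto (h1.mul_const _) ?_
    filter_upwards [eventually_gt_atTop 0, eventually_gt_atTop (2 * r)] with R h0 h2
    have h3 := hB.ncard_mul_sum_le hg ξ S h0.le ((hD (diagPoint m r)).1 (R - 2 * r))
    have h4 : (R - 2 * r) ^ m ≠ 0 := (pow_pos (by linarith) m).ne'
    rw [mul_one, ← sub_eq_add_neg, div_mul_div_cancel₀ h4, div_mul_eq_mul_div,
      div_le_iff₀ (by positivity)]
    exact h3
  -- For finite `S` the tails vanish together as `r → ∞`; the full sum is then reached as a supremum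
  -- of finite sums.
  have hS : ∀ S : Finset K, D * ∑ k ∈ S, ‖𝓕 (g k) ξ‖ ^ 2 ≤ B := by
    intro S
    have h1 : Tendsto (fun r => D * ∑ k ∈ S, max (‖𝓕 (g k) ξ‖ - tailMass (g k) r) 0 ^ 2) atTop
        (𝓝 (D * ∑ k ∈ S, max (‖𝓕 (g k) ξ‖ - 0) 0 ^ 2)) :=
      (tendsto_finsetSum S fun k _ =>
        (((tendsto_const_nhds.sub (tendsto_tailMass (hg k))).max tendsto_const_nhds).pow
          2)).const_mul D
    simp only [sub_zero, max_eq_left (norm_nonneg _)] at h1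
    exact le_of_tendsto h1 (Eventually.of_forall fun r => hr S r)
  rw [← ENNReal.tsum_mul_left]
  refine ENNReal.summable.tsum_le_of_sum_le fun S => ?_
  rw [← Finset.mul_sum]
  calc ENNReal.ofReal D * ∑ k ∈ S, ‖𝓕 (g k) ξ‖ₑ ^ 2
      = ENNReal.ofReal (D * ∑ k ∈ S, ‖𝓕 (g k) ξ‖ ^ 2) := by
        rw [ENNReal.ofReal_mul' (Finset.sum_nonneg fun _ _ => by positivity),
          ENNReal.ofReal_sum_of_nonneg (fun _ _ => by positivity)]
        simp [ENNReal.ofReal_pow]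
    _ ≤ ENNReal.ofReal B := ENNReal.ofReal_le_ofReal (hS S)
    _ = B := ENNReal.ofReal_coe_nnreal

/-! ### Interval windows and smooth weights -/

theorem IsIntervalWindow.exists_eq_Icc {Ω : Set ℝ} (hΩ : IsIntervalWindow Ω) :
    ∃ c d, c ≤ d ∧ Ω = Set.Icc c d := by
  have h := eq_Icc_of_connected_compact ⟨hΩ.nonempty, hΩ.ordConnected.isPreconnected⟩
    hΩ.isCompact
  refine ⟨_, _, ?_, h⟩
  exact Set.nonempty_Icc.1 (h ▸ hΩ.nonempty)

theorem IsSmoothOn.abs_le_supNorm {Ω : Set ℝ} (hΩ : IsCompact Ω) {ψ : ℝ → ℝ}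
    (hψ : IsSmoothOn Ω ψ) (s : ℝ) : |ψ s| ≤ supNorm ψ := by
  have hc : HasCompactSupport ψ := hΩ.of_isClosed_subset (isClosed_tsupport ψ) hψ.2
  obtain ⟨C, hC⟩ := hψ.1.continuous.bounded_above_of_compact_support hc
  have hbdd : BddAbove (Set.range fun s => ‖ψ s‖₊) := by
    refine ⟨C.toNNReal, ?_⟩
    rintro _ ⟨t, rfl⟩
    exact NNReal.le_toNNReal_of_coe_le (hC t)
  exact NNReal.coe_le_coe.2 (le_ciSup hbdd s)

theorem abs_weight_le {Γ : Submodule ℤ (EuclideanSpace ℝ (Fin m) × ℝ)} (Ω : Set ℝ) {ψ : ℝ → ℝ}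
    {M : ℝ} (hM : ∀ s, |ψ s| ≤ M) (x : EuclideanSpace ℝ (Fin m)) : |weight Γ Ω ψ x| ≤ M := by
  unfold weight
  split_ifs with h
  · exact hM _
  · simpa using (abs_nonneg _).trans (hM 0)

theorem IsBessel.const_mul {ι : Type*} {u : ι → EuclideanSpace ℝ (Fin m) → ℂ} {B : ℝ≥0}
    (hu : IsBessel u B) (w : ι → ℝ) {M : ℝ≥0} (hw : ∀ i, |w i| ≤ M) :
    IsBessel (fun i t => (w i : ℂ) * u i t) (M ^ 2 * B) := by
  refine ⟨fun i => (hu.1 i).const_mul _, fun f hf => ?_⟩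
  calc ∑' i, ‖∫ t, f t * conj ((w i : ℂ) * u i t)‖ₑ ^ 2
      ≤ ∑' i, (M : ℝ≥0∞) ^ 2 * ‖∫ t, f t * conj (u i t)‖ₑ ^ 2 := by
        refine ENNReal.tsum_le_tsum fun i => ?_
        have h : ∫ t, f t * conj ((w i : ℂ) * u i t) = (w i : ℂ) * ∫ t, f t * conj (u i t) := by
          rw [← integral_const_mul]
          refine integral_congr_ae (Eventually.of_forall fun t => ?_)
          simp only [map_mul, Complex.conj_ofReal]
          ring
        rw [h, enorm_mul, mul_pow]
        gcongr
        rw [← ofReal_norm, Complex.norm_real, ← ENNReal.ofReal_coe_nnreal]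
        exact ENNReal.ofReal_le_ofReal (hw i)
    _ ≤ _ := by
        rw [ENNReal.tsum_mul_left, ENNReal.coe_mul, ENNReal.coe_pow, mul_assoc]
        gcongr
        exact hu.2 f hf

/-- At frequency `0` the transform is `∫ ψ²`, and `ψ²` is dominated by `‖ψ‖_∞²` times the indicator
of `Ω`. -/
theorem IsSmoothOn.fourier_sq_zero_re_le {Ω : Set ℝ} (hΩ : IsCompact Ω) {ψ : ℝ → ℝ}
    (hψ : IsSmoothOn Ω ψ) :
    (𝓕 (fun s : ℝ => ((ψ s : ℂ) ^ 2)) 0).re ≤ supNorm ψ ^ 2 * (volume Ω).toReal := by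
  have h1 : (𝓕 (fun s : ℝ => ((ψ s : ℂ) ^ 2)) 0) = ((∫ s, ψ s ^ 2 : ℝ) : ℂ) := by
    rw [Real.fourier_eq', ← integral_complex_ofReal]
    refine integral_congr_ae (Eventually.of_forall fun s => ?_)
    simp
  have h2 : ∀ s, ψ s ^ 2 ≤ Ω.indicator (fun _ => (supNorm ψ : ℝ) ^ 2) s := by
    intro s
    by_cases hs : s ∈ Ω
    · rw [Set.indicator_of_mem hs, ← sq_abs]
      exact pow_le_pow_left₀ (abs_nonneg _) (hψ.abs_le_supNorm hΩ s) 2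
    · rw [Set.indicator_of_notMem hs, image_eq_zero_of_notMem_tsupport fun h => hs (hψ.2 h)]
      simp
  rw [h1, Complex.ofReal_re]
  calc ∫ s, ψ s ^ 2 ≤ ∫ s, Ω.indicator (fun _ => (supNorm ψ : ℝ) ^ 2) s := by
        refine integral_mono_of_nonneg (Eventually.of_forall fun s => sq_nonneg _) ?_
          (Eventually.of_forall h2)
        exact (integrable_indicator_iff hΩ.measurableSet).2
          (integrableOn_const hΩ.measure_lt_top.ne)
    _ = _ := by
        rw [integral_indicator hΩ.measurableSet, setIntegral_const, smul_eq_mul, mul_comm]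
        rfl

end ModelSet

theorem proposition4p3 {m : ℕ} (Γ : Submodule ℤ (EuclideanSpace ℝ (Fin m) × ℝ))
    [DiscreteTopology Γ] [IsZLattice ℝ Γ] (hΓ : ModelSet.IsCutProject Γ)
    (Ω : Set ℝ) (hΩ : ModelSet.IsIntervalWindow Ω) (hsymm : ∀ s, s ∈ Ω → -s ∈ Ω)
    {K : Type*} [Countable K] (g : K → EuclideanSpace ℝ (Fin m) → ℂ)
    (hg : ∀ k, ModelSet.MemWiener 2 (g k)) (B : ℝ≥0)
    (hB : ModelSet.IsBessel
      (fun i : K × ModelSet.modelSet Γ Ω => ModelSet.translate (i.2 : EuclideanSpace ℝ (Fin m)) (g i.1))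
      B) :
    (∀ ψ : ℝ → ℝ, ModelSet.IsSmoothOn Ω ψ → (∀ s, 0 ≤ ψ s) →
      ModelSet.IsBessel
        (fun (i : K × ModelSet.modelSet Γ Ω) t =>
          (ModelSet.weight Γ Ω ψ i.2 : ℂ) *
            ModelSet.translate (i.2 : EuclideanSpace ℝ (Fin m)) (g i.1) t)
        (ModelSet.supNorm ψ ^ 2 * B) ∧
      ∀ᵐ t : EuclideanSpace ℝ (Fin m),
        ENNReal.ofReal ((ZLattice.covolume Γ)⁻¹ * (𝓕 (fun s : ℝ => ((ψ s : ℂ) ^ 2)) 0).re) *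
            ∑' k, ‖𝓕 (g k) t‖ₑ ^ 2
          ≤ ((ModelSet.supNorm ψ ^ 2 * B : ℝ≥0) : ℝ≥0∞)) ∧
    ∃ D : ℝ, ModelSet.HasDensity (ModelSet.modelSet Γ Ω) D ∧
      D = (ZLattice.covolume Γ)⁻¹ * (volume Ω).toReal ∧
      ∀ᵐ t : EuclideanSpace ℝ (Fin m),
        ENNReal.ofReal D * ∑' k, ‖𝓕 (g k) t‖ₑ ^ 2 ≤ (B : ℝ≥0∞) := by

  have hint : ∀ k, Integrable (g k) := fun k => (hg k).integrable
  have hdens : ModelSet.HasDensity (ModelSet.modelSet Γ Ω)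
      ((ZLattice.covolume Γ)⁻¹ * (volume Ω).toReal) := by
    obtain ⟨c, d, hcd, rfl⟩ := hΩ.exists_eq_Icc
    rw [Real.volume_Icc, ENNReal.toReal_ofReal (sub_nonneg.2 hcd)]
    exact hΓ.hasDensity_modelSet hcd
  have hmain := fun t => hB.density_mul_tsum_le hdens hint t
  refine ⟨fun ψ hψ _ => ⟨?_, Eventually.of_forall fun t => ?_⟩,
    _, hdens, rfl, Eventually.of_forall hmain⟩
  · exact hB.const_mul
      (fun i : K × ModelSet.modelSet Γ Ω => ModelSet.weight Γ Ω ψ i.2)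
      fun i => ModelSet.abs_weight_le Ω (hψ.abs_le_supNorm hΩ.isCompact) _
  · have hV : 0 ≤ (ZLattice.covolume Γ)⁻¹ :=
      inv_nonneg.2 (ZLattice.covolume_pos Γ volume).le
    -- The weighted bound comes from the density bound for the unweighted system, multiplied by
    -- `‖ψ‖_∞²`.
    calc _ ≤ ENNReal.ofReal ((ModelSet.supNorm ψ : ℝ) ^ 2 *
          ((ZLattice.covolume Γ)⁻¹ * (volume Ω).toReal)) * ∑' k, ‖𝓕 (g k) t‖ₑ ^ 2 := by
          refine mul_le_mul_left (ENNReal.ofReal_le_ofReal ?_) _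
          rw [mul_left_comm]
          exact mul_le_mul_of_nonneg_left (hψ.fourier_sq_zero_re_le hΩ.isCompact) hV
      _ ≤ _ := by
          rw [ENNReal.ofReal_mul (by positivity), ENNReal.ofReal_pow (by positivity),
            ENNReal.ofReal_coe_nnreal, ENNReal.coe_mul, ENNReal.coe_pow, mul_assoc]
          gcongr
          exact hmain t
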